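/- Let $d\ge 1$ and $0<\alpha\le 2$. For $t>0$ let $p_t(x,y)=p_t(x-y)$, $x,y\in\mathbb{R}^d$, be the transition density of the rotationally invariant $\alpha$-stable process on $\mathbb{R}^d$, that is, $\int_{\mathbb{R}^d}e^{-i y\cdot\xi}p_t(y)\,dy=e^{-t|\xi|^\alpha}$ for all $\xi\in\mathbb{R}^d$. Let $\mathbb{E}^t_{x,y}$ denote the expectation with respect to the stable bridge, i.e. the stable process $X=(X_s)_{0\le s\le t}$ (with right-continuous paths having left limits) started at $x$ and conditioned to be at $y$ at time $t$, whose finite-dimensional distributions at times $0<s_1<\dots<s_k<t$ have the density $\frac{1}{p_t(x,y)}\prod_{j=0}^{k}p_{s_{j+1}-s_j}(z_j,z_{j+1})$, where $s_0=0$, $z_0=x$, $s_{k+1}=t$, $z_{k+1}=y$. For $V:\mathbb{R}^d\to\mathbb{R}$ in $L^\infty(\mathbb{R}^d)\cap L^1(\mathbb{R}^d)$ let $$p_t^{H_V}(x,y)=p_t(x,y)\,\mathbb{E}^t_{x,y}\!\left[e^{-\int_0^t V(X_s)\,ds}\right]$$ be the heat kernel of $H_V=(-\Delta)^{\alpha/2}+V$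 and let $$Q_V^{(\alpha)}(t)=\int_{\mathbb{R}^d}\int_{\mathbb{R}^d}\left\{p_t^{H_V}(x,y)-p_t(x,y)\right\}dx\,dy .$$ Then these integrals converge (absolutely, over $\mathbb{R}^d\times\mathbb{R}^d$) for all $t>0$, and the following hold. (i) If $V\le 0$, then for all $t>0$ $$-t\int_{\mathbb{R}^d}V(x)\,dx\;\le\; Q_V^{(\alpha)}(t)\;\le\;-t\int_{\mathbb{R}^d}V(x)\,dx\left(1+\tfrac12\, t\,\|V\|_\infty e^{t\|V\|_\infty}\right),$$ and $Q_V^{(\alpha)}(t)=-t\int_{\mathbb{R}^d}V(x)\,dx+\mathcal{O}(t^2)$ as $t\downarrow0$. (ii) In general, for all $t>0$ $$\left|Q_V^{(\alpha)}(t)+t\int_{\mathbb{R}^d}V(x)\,dx\right|\le t^2\,\|V\|_1\|V\|_\infty e^{t\|V\|_\infty},$$ and $Q_V^{(\alpha)}(t)=-t\int_{\mathbb{R}^d}V(x)\,dx+\mathcal{O}(t^2)$ as $t\downarrow0$. -/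

import Mathlib

open MeasureTheory Set Filter Topology
open scoped FourierTransform

noncomputable section

/-- The transition density `p_t(z)` of the rotationally invariant `α`-stable process on `ℝ^d`, so
that `p_t(x, y) = p_t(x - y)`: the function whose Fourier transform is `exp (-t |η|^α)`, given by
Fourier inversion. Mathlib normalises `𝓕 g (ξ) = ∫ exp (-2πi ⟨z, ξ⟩) g z`, so the frequency `η` of
the characteristic function is `2πξ`. -/
def stableDensity {d : ℕ} (α t : ℝ) (z : EuclideanSpace ℝ (Fin d)) : ℝ :=
  (𝓕⁻ (fun ξ : EuclideanSpace ℝ (Fin d) =>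
    ((Real.exp (-(t * ‖(2 * Real.pi) • ξ‖ ^ α)) : ℝ) : ℂ)) z).re

/-- The joint density at `(z 0, …, z (k-1))` of the `α`-stable bridge from `x` (at time `0`) to
`y` (at time `t`), observed at the times `s 0 < … < s (k-1)` of `(0, t)`:
`∏ⱼ p_{s j - s (j-1)}(z (j-1), z j) / p_t(x, y)`, with time `0` and point `x` put before the
observations, and time `t` and point `y` after them. -/
def bridgeDensity {d : ℕ} (α t : ℝ) (x y : EuclideanSpace ℝ (Fin d)) {k : ℕ} (s : Fin k → ℝ)
    (z : Fin k → EuclideanSpace ℝ (Fin d)) : ℝ :=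
  let τ : Fin (k + 2) → ℝ :=
    Fin.cons (α := fun _ => ℝ) 0 (Fin.snoc (α := fun _ => ℝ) s t)
  let w : Fin (k + 2) → EuclideanSpace ℝ (Fin d) :=
    Fin.cons (α := fun _ => EuclideanSpace ℝ (Fin d)) x
      (Fin.snoc (α := fun _ => EuclideanSpace ℝ (Fin d)) z y)
  (∏ j : Fin (k + 1),
      stableDensity α (τ j.succ - τ j.castSucc) (w j.castSucc - w j.succ)) /
    stableDensity α t (x - y)

/-- Under the probability measure `P`, the process `X` on the time interval `[0, t]` is an
`α`-stable bridge from `x` to `y` of length `t`: it starts at `x`, is at `y` at time `t`, has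
almost surely right-continuous paths with left limits, and has the finite-dimensional
distributions of the `α`-stable process started at `x` and conditioned to be at `y` at time `t`. -/
structure IsStableBridge {d : ℕ} {Ω : Type*} [MeasurableSpace Ω] (α t : ℝ)
    (x y : EuclideanSpace ℝ (Fin d)) (X : ℝ → Ω → EuclideanSpace ℝ (Fin d))
    (P : Measure Ω) : Prop where
  isProbabilityMeasure : IsProbabilityMeasure P
  measurable : ∀ s ∈ Icc 0 t, Measurable (X s)
  start : ∀ᵐ ω ∂P, X 0 ω = x
  finish : ∀ᵐ ω ∂P, X t ω = y
  right_continuous : ∀ᵐ ω ∂P, ∀ s ∈ Ico 0 t,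
    Tendsto (fun u => X u ω) (𝓝[>] s) (𝓝 (X s ω))
  left_limits : ∀ᵐ ω ∂P, ∀ s ∈ Ioc 0 t,
    ∃ l, Tendsto (fun u => X u ω) (𝓝[<] s) (𝓝 l)
  finite_dimensional : ∀ (k : ℕ) (s : Fin k → ℝ), StrictMono s → (∀ i, s i ∈ Ioo 0 t) →
    P.map (fun ω i => X (s i) ω) =
      (volume : Measure (Fin k → EuclideanSpace ℝ (Fin d))).withDensity
        (fun z => ENNReal.ofReal (bridgeDensity α t x y s z))

/-- The heat kernel `p_t^{H_V}(x, y)` of `H_V = (-Δ)^{α/2} + V`, given by the Feynman–Kac formula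
`p_t(x, y) E^t_{x,y}[exp (-∫₀ᵗ V(X_s) ds)]`, where `P t x y` is the law of the bridge. -/
def schrodingerKernel {d : ℕ} {Ω : Type*} [MeasurableSpace Ω] (α : ℝ)
    (X : ℝ → Ω → EuclideanSpace ℝ (Fin d))
    (P : ℝ → EuclideanSpace ℝ (Fin d) → EuclideanSpace ℝ (Fin d) → Measure Ω)
    (V : EuclideanSpace ℝ (Fin d) → ℝ) (t : ℝ) (x y : EuclideanSpace ℝ (Fin d)) : ℝ :=
  stableDensity α t (x - y) * ∫ ω, Real.exp (-∫ s in (0 : ℝ)..t, V (X s ω)) ∂(P t x y)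

/-- The heat content `Q_V(t) = ∫∫ (p_t^{H_V}(x, y) - p_t(x, y)) dx dy`. -/
def heatContent {d : ℕ} {Ω : Type*} [MeasurableSpace Ω] (α : ℝ)
    (X : ℝ → Ω → EuclideanSpace ℝ (Fin d))
    (P : ℝ → EuclideanSpace ℝ (Fin d) → EuclideanSpace ℝ (Fin d) → Measure Ω)
    (V : EuclideanSpace ℝ (Fin d) → ℝ) (t : ℝ) : ℝ :=
  ∫ y, ∫ x, (schrodingerKernel α X P V t x y - stableDensity α t (x - y))

/-- The heat content at time `t` is a convergent expression: under every bridge measure the path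
integral of `V` almost surely converges and the Feynman–Kac functional is integrable, and
`p_t^{H_V} - p_t` is integrable on `ℝ^d × ℝ^d`. -/
def HeatContentConverges {d : ℕ} {Ω : Type*} [MeasurableSpace Ω] (α : ℝ)
    (X : ℝ → Ω → EuclideanSpace ℝ (Fin d))
    (P : ℝ → EuclideanSpace ℝ (Fin d) → EuclideanSpace ℝ (Fin d) → Measure Ω)
    (V : EuclideanSpace ℝ (Fin d) → ℝ) (t : ℝ) : Prop :=
  (∀ x y, (∀ᵐ ω ∂(P t x y), IntervalIntegrable (fun s => V (X s ω)) volume 0 t) ∧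
    Integrable (fun ω => Real.exp (-∫ s in (0 : ℝ)..t, V (X s ω))) (P t x y)) ∧
  Integrable (fun z : EuclideanSpace ℝ (Fin d) × EuclideanSpace ℝ (Fin d) =>
    schrodingerKernel α X P V t z.1 z.2 - stableDensity α t (z.1 - z.2)) (volume.prod volume)

end

/-!
Write `a = ∫₀ᵗ V(X_s) ds`. The heat content is `∫∫ p_t(x, y) E_{x,y}[e^{-a} - 1] dx dy`, and
`e^{-a} - 1 = -a + R` with `0 ≤ R ≤ ½ a² e^{|a|}`. Since `|a| ≤ t ‖V‖_∞`, the remainder satisfies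
`R ≤ ½ t ‖V‖_∞ e^{t ‖V‖_∞} ∫₀ᵗ |V(X_s)| ds`, so everything reduces to first moments
(`abs_exp_path_sub_le`). At time `s` the bridge has density
`p_s(x - z) p_{t-s}(z - y) / p_t(x - y)`; by Fubini the end points may be integrated out first, and
as `∫ p_s = ∫ p_{t-s} = 1`, the first moment `∫∫ p_t(x, y) E_{x,y}[∫₀ᵗ U(X_s) ds] dx dy` equals
`t ∫ U` (`integral_firstMoment`). Taking `U = V` gives the main term, `U = |V|` the error term. The
bounds are thus `0 ≤ Q_V(t) + t ∫ V ≤ ½ t² ‖V‖₁ ‖V‖_∞ e^{t ‖V‖_∞}` for every `V`, from which the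
assertions for `V ≤ 0` and for general `V` follow.

Three facts are needed to make this rigorous.

* `p_t > 0` and `∫ p_t = 1`. The finite-dimensional distributions of the bridge, being probability
  measures, force `p_t(x - y) ≠ 0`; as `p_t` is continuous and positive at the origin, it is
  positive. Its total mass is then computed by Gaussian regularisation and monotone convergence
  (`lintegral_stableDensity`).
* Joint measurability of `(ω, s) ↦ X_s(ω)`, from right-continuity
  (`IsStableBridge.aemeasurable_uncurry`). Together with the one-time densities it shows that paths
  spend no time in Lebesgue-null sets, so that `V` may be replaced by a bounded Borel representative.
* Measurability of `(x, y) ↦ E_{x,y}[e^{-a}]` (`stronglyMeasurable_feynmanKac`). The bridge laws are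
  only known through their finite-dimensional densities, which are measurable in the end points.
  For continuous `V` the functional is a limit of functionals of finitely many positions, by
  right-endpoint Riemann sums, and a general `V` is an almost everywhere limit of uniformly bounded
  continuous functions.
-/

/-! ### The stable density -/

/-- The characteristic function `exp (-t |η|^α)` of the `α`-stable law at time `t`, in Mathlib's
frequency variable `η = 2πξ`. -/
noncomputable def stableCharFun (d : ℕ) (α t : ℝ) (ξ : EuclideanSpace ℝ (Fin d)) : ℂ :=
  ((Real.exp (-(t * ‖(2 * Real.pi) • ξ‖ ^ α)) : ℝ) : ℂ)

lemma continuous_stableCharFun {d : ℕ} {α : ℝ} (hα : 0 < α) :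
    Continuous fun q : ℝ × EuclideanSpace ℝ (Fin d) => stableCharFun d α q.1 q.2 := by
  unfold stableCharFun
  have : Continuous fun q : ℝ × EuclideanSpace ℝ (Fin d) => ‖(2 * Real.pi) • q.2‖ ^ α :=
    Continuous.rpow_const (by fun_prop) (fun _ => Or.inr hα.le)
  fun_prop

lemma integrable_stableCharFun {d : ℕ} (hd : 1 ≤ d) {α t : ℝ} (hα : 0 < α) (ht : 0 < t) :
    Integrable (stableCharFun d α t) := by
  have : Nonempty (Fin d) := ⟨⟨0, hd⟩⟩
  refine Integrable.ofReal (𝕜 := ℂ)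
    (f := fun ξ : EuclideanSpace ℝ (Fin d) => Real.exp (-(t * ‖(2 * Real.pi) • ξ‖ ^ α))) ?_
  have hpi : (0 : ℝ) < 2 * Real.pi := by positivity
  have key : Integrable (fun ξ : EuclideanSpace ℝ (Fin d) =>
      (fun r : ℝ => Real.exp (-(t * (2 * Real.pi) ^ α) * r ^ α)) ‖ξ‖) := by
    rw [integrable_fun_norm_addHaar volume
      (f := fun r : ℝ => Real.exp (-(t * (2 * Real.pi) ^ α) * r ^ α))]
    have h := integrableOn_rpow_mul_exp_neg_mul_rpow (p := α)
      (s := ((Module.finrank ℝ (EuclideanSpace ℝ (Fin d)) - 1 : ℕ) : ℝ))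
      (b := t * (2 * Real.pi) ^ α) (by
        have : (0 : ℝ) ≤ ((Module.finrank ℝ (EuclideanSpace ℝ (Fin d)) - 1 : ℕ) : ℝ) :=
          Nat.cast_nonneg _
        linarith) hα (by positivity)
    simpa only [Real.rpow_natCast, smul_eq_mul] using h
  refine key.congr (Eventually.of_forall fun ξ => ?_)
  simp only [norm_smul, Real.norm_eq_abs, abs_of_pos hpi]
  rw [Real.mul_rpow hpi.le (norm_nonneg _)]
  ring_nf

lemma stableDensity_eq_re_fourier {d : ℕ} (α t : ℝ) (z : EuclideanSpace ℝ (Fin d)) :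
    stableDensity α t z = (𝓕 (stableCharFun d α t) z).re := by
  unfold stableDensity
  rw [Real.fourierInv_eq_fourier_comp_neg]
  simp only [smul_neg, norm_neg]
  rfl

lemma continuous_fourier_stableCharFun {d : ℕ} (hd : 1 ≤ d) {α t : ℝ} (hα : 0 < α)
    (ht : 0 < t) : Continuous (𝓕 (stableCharFun d α t)) :=
  VectorFourier.fourierIntegral_continuous Real.continuous_fourierChar
    (innerSL ℝ).continuous₂ (integrable_stableCharFun hd hα ht)

lemma continuous_stableDensity {d : ℕ} (hd : 1 ≤ d) {α t : ℝ} (hα : 0 < α) (ht : 0 < t) :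
    Continuous (stableDensity (d := d) α t) := by
  have : stableDensity (d := d) α t = fun z => (𝓕 (stableCharFun d α t) z).re :=
    funext (stableDensity_eq_re_fourier α t)
  rw [this]
  exact Complex.continuous_re.comp (continuous_fourier_stableCharFun hd hα ht)

lemma measurable_stableDensity {d : ℕ} {α : ℝ} (hα : 0 < α) :
    Measurable fun q : ℝ × EuclideanSpace ℝ (Fin d) => stableDensity α q.1 q.2 := by
  simp_rw [stableDensity_eq_re_fourier, Real.fourier_eq']
  refine Complex.measurable_re.comp (StronglyMeasurable.measurable ?_)
  refine StronglyMeasurable.integral_prod_right' (ν := volume)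
    (f := fun r : (ℝ × EuclideanSpace ℝ (Fin d)) × EuclideanSpace ℝ (Fin d) =>
      Complex.exp (↑(-2 * Real.pi * inner ℝ r.2 r.1.2) * Complex.I) •
        stableCharFun d α r.1.1 r.2) ?_
  have h := (continuous_stableCharFun (d := d) hα).comp
    (f := fun r : (ℝ × EuclideanSpace ℝ (Fin d)) × EuclideanSpace ℝ (Fin d) => (r.1.1, r.2))
    (by fun_prop)
  refine Continuous.stronglyMeasurable (Continuous.smul (f := fun r :
    (ℝ × EuclideanSpace ℝ (Fin d)) × EuclideanSpace ℝ (Fin d) =>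
      Complex.exp (↑(-2 * Real.pi * inner ℝ r.2 r.1.2) * Complex.I)) ?_ h)
  fun_prop

lemma stableDensity_zero_pos {d : ℕ} (hd : 1 ≤ d) {α t : ℝ} (hα : 0 < α) (ht : 0 < t) :
    0 < stableDensity α t (0 : EuclideanSpace ℝ (Fin d)) := by
  have hi := integrable_stableCharFun hd hα ht
  have h : stableDensity α t (0 : EuclideanSpace ℝ (Fin d)) =
      ∫ ξ : EuclideanSpace ℝ (Fin d), Real.exp (-(t * ‖(2 * Real.pi) • ξ‖ ^ α)) := by
    rw [stableDensity_eq_re_fourier, Real.fourier_eq']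
    simp only [inner_zero_right, mul_zero, Complex.ofReal_zero, zero_mul, Complex.exp_zero,
      one_smul]
    unfold stableCharFun
    rw [integral_complex_ofReal, Complex.ofReal_re]
  rw [h]
  refine integral_exp_pos ?_
  exact hi.re.congr (Eventually.of_forall fun ξ => Complex.ofReal_re _)

/-- The density has no zero, is continuous and is positive at the origin, so it is positive. -/
lemma stableDensity_pos_of_ne_zero {d : ℕ} (hd : 1 ≤ d) {α t : ℝ} (hα : 0 < α) (ht : 0 < t)
    (hne : ∀ z : EuclideanSpace ℝ (Fin d), stableDensity α t z ≠ 0)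
    (z : EuclideanSpace ℝ (Fin d)) : 0 < stableDensity α t z := by
  by_contra! hz
  obtain ⟨w, hw⟩ := mem_range_of_exists_le_of_exists_ge (continuous_stableDensity hd hα ht)
    ⟨z, hz⟩ ⟨0, (stableDensity_zero_pos hd hα ht).le⟩
  exact hne w hw

/-- Gaussian regularisation of `∫ p_t`: pairing `p_t` with a wide Gaussian is, by self-adjointness
of the Fourier transform, the pairing of `exp (-t |·|^α)` with an approximate identity at `0`. -/
lemma tendsto_integral_gaussian_mul_stableDensity {d : ℕ} (hd : 1 ≤ d) {α t : ℝ} (hα : 0 < α)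
    (ht : 0 < t) :
    Tendsto (fun c : ℝ => ∫ z : EuclideanSpace ℝ (Fin d),
      Real.exp (-c⁻¹ * ‖z‖ ^ 2) * stableDensity α t z) atTop (𝓝 1) := by
  have hi := integrable_stableCharFun hd hα ht
  have hc0 : Continuous (stableCharFun d α t) :=
    (continuous_stableCharFun hα).comp (f := fun ξ => (t, ξ)) (by fun_prop)
  have A := Real.tendsto_integral_gaussian_smul' hi (v := 0) hc0.continuousAt
  have h0 : stableCharFun d α t 0 = 1 := by
    simp [stableCharFun, Real.zero_rpow hα.ne']
  rw [h0] at A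
  have B := (Complex.continuous_re.tendsto 1).comp A
  rw [Complex.one_re] at B
  refine B.congr' ?_
  filter_upwards [Ioi_mem_atTop 0] with c (hc : 0 < c)
  have J : Integrable (fun w : EuclideanSpace ℝ (Fin d) =>
      Complex.exp (- (c⁻¹ : ℂ) * ‖w‖ ^ 2)) := by
    simpa using GaussianFourier.integrable_cexp_neg_mul_sq_norm_add (b := (c⁻¹ : ℂ))
      (V := EuclideanSpace ℝ (Fin d)) (by simpa using hc) 0 0
  have S : ∫ w : EuclideanSpace ℝ (Fin d), 𝓕 (fun w : EuclideanSpace ℝ (Fin d) =>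
        Complex.exp (- (c⁻¹ : ℂ) * ‖w‖ ^ 2)) w • stableCharFun d α t w =
      ∫ w, Complex.exp (- (c⁻¹ : ℂ) * ‖w‖ ^ 2) • 𝓕 (stableCharFun d α t) w := by
    simpa using! VectorFourier.integral_fourierIntegral_smul_eq_flip
      (L := innerₗ (EuclideanSpace ℝ (Fin d))) Real.continuous_fourierChar continuous_inner J hi
  have T : ∫ w : EuclideanSpace ℝ (Fin d),
      ((Real.pi * c : ℂ) ^ (Module.finrank ℝ (EuclideanSpace ℝ (Fin d)) / 2 : ℂ) *
        Complex.exp (-Real.pi ^ 2 * c * ‖0 - w‖ ^ 2)) • stableCharFun d α t w =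
      ∫ w, Complex.exp (- (c⁻¹ : ℂ) * ‖w‖ ^ 2) • 𝓕 (stableCharFun d α t) w := by
    rw [← S]
    congr with w
    rw [fourier_gaussian_innerProductSpace (by simpa using hc)]
    simp only [zero_sub, norm_neg, div_inv_eq_mul]
    congr 3
    ring
  have hb : Integrable fun w => Complex.exp (- (c⁻¹ : ℂ) * ‖w‖ ^ 2) •
      𝓕 (stableCharFun d α t) w := by
    refine Integrable.smul_bdd (C := ∫ v, ‖stableCharFun d α t v‖) J
      (continuous_fourier_stableCharFun hd hα ht).aestronglyMeasurable
      (Eventually.of_forall fun w => ?_)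
    exact VectorFourier.norm_fourierIntegral_le_integral_norm _ _ _ _ _
  simp only [Function.comp_apply]
  rw [T]
  have hre := integral_re hb
  simp only [RCLike.re_eq_complex_re] at hre
  rw [← hre]
  congr with w
  rw [stableDensity_eq_re_fourier]
  have : Complex.exp (- (c⁻¹ : ℂ) * ‖w‖ ^ 2) = ((Real.exp (-c⁻¹ * ‖w‖ ^ 2) : ℝ) : ℂ) := by
    push_cast; rfl
  rw [this, smul_eq_mul, Complex.re_ofReal_mul]

lemma lintegral_stableDensity {d : ℕ} (hd : 1 ≤ d) {α t : ℝ} (hα : 0 < α) (ht : 0 < t)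
    (hpos : ∀ z : EuclideanSpace ℝ (Fin d), 0 < stableDensity α t z) :
    ∫⁻ z : EuclideanSpace ℝ (Fin d), ENNReal.ofReal (stableDensity α t z) = 1 := by
  have hcont := continuous_stableDensity hd hα ht
  have hn1 : Tendsto (fun n : ℕ => (n : ℝ) + 1) atTop atTop :=
    tendsto_atTop_add_const_right _ _ tendsto_natCast_atTop_atTop
  have hlim := (tendsto_integral_gaussian_mul_stableDensity hd hα ht).comp hn1
  have hcvg : Tendsto (fun n : ℕ => ∫⁻ z : EuclideanSpace ℝ (Fin d),
      ENNReal.ofReal (Real.exp (-((n : ℝ) + 1)⁻¹ * ‖z‖ ^ 2) * stableDensity α t z)) atTop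
      (𝓝 1) := by
    have := ENNReal.tendsto_ofReal hlim
    rw [ENNReal.ofReal_one] at this
    -- The regularised integrals tend to `1`, so they are eventually positive; in particular they
    -- are then not the junk value `0` of a divergent Bochner integral.
    refine this.congr' ?_
    filter_upwards [hlim.eventually (lt_mem_nhds (zero_lt_one' ℝ))] with n hn
    simp only [Function.comp_apply] at hn ⊢
    refine ofReal_integral_eq_lintegral_ofReal ?_ (Eventually.of_forall fun z => ?_)
    · by_contra hni
      rw [integral_undef hni] at hn
      exact lt_irrefl _ hn
    · exact mul_nonneg (Real.exp_pos _).le (hpos z).le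
  refine tendsto_nhds_unique (lintegral_tendsto_of_tendsto_of_monotone ?_ ?_ ?_) hcvg
  · exact fun n => (by fun_prop : Measurable _).aemeasurable
  · refine Eventually.of_forall fun z n m hnm => ?_
    refine ENNReal.ofReal_le_ofReal (mul_le_mul_of_nonneg_right ?_ (hpos z).le)
    refine Real.exp_le_exp.2 (mul_le_mul_of_nonneg_right (neg_le_neg ?_) (sq_nonneg _))
    gcongr
  · refine Eventually.of_forall fun z => ENNReal.tendsto_ofReal ?_
    have h1 : Tendsto (fun n : ℕ => ((n : ℝ) + 1)⁻¹) atTop (𝓝 0) :=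
      tendsto_inv_atTop_zero.comp hn1
    have h2 : Tendsto (fun n : ℕ => Real.exp (-((n : ℝ) + 1)⁻¹ * ‖z‖ ^ 2) *
        stableDensity α t z) atTop
        (𝓝 (Real.exp (-0 * ‖z‖ ^ 2) * stableDensity α t z)) :=
      (Real.continuous_exp.tendsto _ |>.comp ((h1.neg).mul_const _)).mul_const _
    simpa using h2

lemma integrable_stableDensity {d : ℕ} (hd : 1 ≤ d) {α t : ℝ} (hα : 0 < α) (ht : 0 < t)
    (hpos : ∀ z : EuclideanSpace ℝ (Fin d), 0 < stableDensity α t z) :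
    Integrable (stableDensity (d := d) α t) := by
  refine ⟨(continuous_stableDensity hd hα ht).aestronglyMeasurable, ?_⟩
  rw [hasFiniteIntegral_iff_ofReal (Eventually.of_forall fun z => (hpos z).le),
    lintegral_stableDensity hd hα ht hpos]
  exact ENNReal.one_lt_top

lemma integral_stableDensity {d : ℕ} (hd : 1 ≤ d) {α t : ℝ} (hα : 0 < α) (ht : 0 < t)
    (hpos : ∀ z : EuclideanSpace ℝ (Fin d), 0 < stableDensity α t z) :
    ∫ z : EuclideanSpace ℝ (Fin d), stableDensity α t z = 1 := by
  rw [integral_eq_lintegral_of_nonneg_ae (Eventually.of_forall fun z => (hpos z).le)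
    (continuous_stableDensity hd hα ht).aestronglyMeasurable,
    lintegral_stableDensity hd hα ht hpos, ENNReal.toReal_one]

/-! ### Approximation of times from the right -/

/-- The first point of the grid `(t / (n + 1)) ℕ` to the right of `s`, capped at `t`. -/
noncomputable def gridTime (t : ℝ) (n : ℕ) (s : ℝ) : ℝ :=
  min (t * ((⌊s * (n + 1) / t⌋₊ + 1 : ℕ) : ℝ) / (n + 1)) t

lemma tendsto_gridTime {t s : ℝ} (hs : s ∈ Ioo 0 t) :
    Tendsto (fun n => gridTime t n s) atTop (𝓝[>] s) := by
  have ht : 0 < t := hs.1.trans hs.2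
  have hlow : ∀ n : ℕ, s < gridTime t n s := fun n => by
    refine lt_min ?_ hs.2
    have hn : (0 : ℝ) < n + 1 := by positivity
    rw [lt_div_iff₀ hn, ← div_lt_iff₀' ht]
    exact_mod_cast Nat.lt_floor_add_one (s * ((n : ℝ) + 1) / t)
  have hup : ∀ n : ℕ, gridTime t n s ≤ s + t * (1 / ((n : ℝ) + 1)) := fun n => by
    refine (min_le_left _ _).trans ?_
    have hn : (0 : ℝ) < n + 1 := by positivity
    have hf := Nat.floor_le (a := s * ((n : ℝ) + 1) / t)
      (div_nonneg (mul_nonneg hs.1.le hn.le) ht.le)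
    have : t * (⌊s * ((n : ℝ) + 1) / t⌋₊ : ℝ) ≤ s * (n + 1) := by
      rwa [← le_div_iff₀' ht]
    rw [div_le_iff₀ hn, add_mul, mul_assoc, one_div_mul_cancel hn.ne']
    push_cast
    linarith
  refine tendsto_nhdsWithin_iff.2 ⟨?_, Eventually.of_forall hlow⟩
  have hlim : Tendsto (fun n : ℕ => s + t * (1 / ((n : ℝ) + 1))) atTop (𝓝 s) := by
    simpa using (tendsto_one_div_add_atTop_nhds_zero_nat (𝕜 := ℝ)).const_mul t |>.const_add s
  exact tendsto_of_tendsto_of_tendsto_of_le_of_le tendsto_const_nhds hlim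
    (fun n => (hlow n).le) hup

/-! ### Marginals and occupation measure of the bridge -/

/-- The density at `z` of the position at time `s` of the `α`-stable bridge of length `t` from `x`
to `y`. -/
noncomputable def bridgeMarginal {d : ℕ} (α t : ℝ) (x y : EuclideanSpace ℝ (Fin d)) (s : ℝ)
    (z : EuclideanSpace ℝ (Fin d)) : ℝ :=
  stableDensity α s (x - z) * stableDensity α (t - s) (z - y) / stableDensity α t (x - y)

lemma bridgeDensity_fin_one {d : ℕ} (α t : ℝ) (x y : EuclideanSpace ℝ (Fin d)) (s : Fin 1 → ℝ)
    (z : Fin 1 → EuclideanSpace ℝ (Fin d)) :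
    bridgeDensity α t x y s z = bridgeMarginal α t x y (s 0) (z 0) := by
  simp [bridgeDensity, bridgeMarginal, Fin.prod_univ_succ, Fin.snoc]

lemma measurable_bridgeMarginal {d : ℕ} {α : ℝ} (hα : 0 < α) (t : ℝ)
    (x y : EuclideanSpace ℝ (Fin d)) :
    Measurable fun q : ℝ × EuclideanSpace ℝ (Fin d) => bridgeMarginal α t x y q.1 q.2 := by
  have h := measurable_stableDensity (d := d) hα
  unfold bridgeMarginal
  refine Measurable.div_const (Measurable.mul ?_ ?_) _
  · exact h.comp (g := fun q : ℝ × EuclideanSpace ℝ (Fin d) => stableDensity α q.1 q.2)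
      (f := fun q : ℝ × EuclideanSpace ℝ (Fin d) => (q.1, x - q.2)) (by fun_prop)
  · exact h.comp (g := fun q : ℝ × EuclideanSpace ℝ (Fin d) => stableDensity α q.1 q.2)
      (f := fun q : ℝ × EuclideanSpace ℝ (Fin d) => (t - q.1, q.2 - y)) (by fun_prop)

namespace IsStableBridge

variable {d : ℕ} {Ω : Type*} [MeasurableSpace Ω] {α t : ℝ} {x y : EuclideanSpace ℝ (Fin d)}
  {X : ℝ → Ω → EuclideanSpace ℝ (Fin d)} {P : Measure Ω}

/-- The finite-dimensional distributions are probability measures, so their common normalisation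
`p_t(x, y)` does not vanish. -/
lemma stableDensity_ne_zero (h : IsStableBridge α t x y X P) :
    stableDensity α t (x - y) ≠ 0 := by
  intro h0
  have := h.isProbabilityMeasure
  have hfd := h.finite_dimensional 0 Fin.elim0 (fun i => i.elim0) (fun i => i.elim0)
  have hm : Measurable fun (ω : Ω) (i : Fin 0) => X (Fin.elim0 i) ω :=
    measurable_pi_lambda _ fun i => i.elim0
  have hp : IsProbabilityMeasure (P.map fun (ω : Ω) (i : Fin 0) => X (Fin.elim0 i) ω) :=
    Measure.isProbabilityMeasure_map hm.aemeasurable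
  have h1 := hp.measure_univ
  rw [hfd] at h1
  simp [bridgeDensity, h0] at h1

lemma map_apply (h : IsStableBridge α t x y X P) {s : ℝ} (hs : s ∈ Ioo 0 t) :
    P.map (X s) = volume.withDensity fun z => ENNReal.ofReal (bridgeMarginal α t x y s z) := by
  have hfd := h.finite_dimensional 1 (fun _ => s) (Subsingleton.strictMono _) (fun _ => hs)
  have hm : Measurable fun (ω : Ω) (_ : Fin 1) => X s ω :=
    measurable_pi_lambda _ fun _ => h.measurable s ⟨hs.1.le, hs.2.le⟩
  have hpr := volume_preserving_funUnique (Fin 1) (EuclideanSpace ℝ (Fin d))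
  have h2 : P.map (X s) = (P.map fun (ω : Ω) (_ : Fin 1) => X s ω).map
      (MeasurableEquiv.funUnique (Fin 1) (EuclideanSpace ℝ (Fin d))) := by
    rw [Measure.map_map (MeasurableEquiv.measurable _) hm]
    rfl
  rw [h2, hfd]
  ext A hA
  rw [MeasurableEquiv.map_apply, withDensity_apply _ (MeasurableEquiv.measurable _ hA),
    withDensity_apply _ hA, ← hpr.setLIntegral_comp_preimage_emb
      (MeasurableEquiv.measurableEmbedding _)]
  refine setLIntegral_congr_fun (MeasurableEquiv.measurable _ hA) fun z _ => ?_
  simp only [bridgeDensity_fin_one]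
  rfl

/-- Right-continuity of the paths makes the bridge jointly measurable in chance and time. -/
lemma aemeasurable_uncurry (h : IsStableBridge α t x y X P) (ht : 0 < t) :
    AEMeasurable (fun q : Ω × ℝ => X q.2 q.1) (P.prod (volume.restrict (Ioc 0 t))) := by
  have := h.isProbabilityMeasure
  refine aemeasurable_of_tendsto_metrizable_ae (u := atTop)
    (f := fun n (q : Ω × ℝ) => X (gridTime t n q.2) q.1) (fun n => Measurable.aemeasurable ?_) ?_
  · have hk : Measurable fun r : ℕ × Ω => X (min (t * ((r.1 : ℕ) : ℝ) / (n + 1)) t) r.2 := by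
      refine measurable_from_prod_countable_right fun k => ?_
      exact h.measurable (min (t * ((k : ℕ) : ℝ) / (n + 1)) t)
        ⟨le_min (by positivity) ht.le, min_le_right _ _⟩
    refine hk.comp (f := fun q : Ω × ℝ => (⌊q.2 * (n + 1) / t⌋₊ + 1, q.1)) ?_
    refine Measurable.prodMk ?_ measurable_fst
    exact (Nat.measurable_floor.comp (by fun_prop)).add_const 1
  · have h1 := Measure.quasiMeasurePreserving_fst (μ := P)
      (ν := volume.restrict (Ioc 0 t)) |>.ae h.right_continuous
    have h2 : ∀ᵐ q ∂(P.prod (volume.restrict (Ioc 0 t))), q.2 ∈ Ioo 0 t := by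
      refine Measure.quasiMeasurePreserving_snd (μ := P)
        (ν := volume.restrict (Ioc 0 t)) |>.ae ?_
      rw [← restrict_Ioo_eq_restrict_Ioc]
      exact ae_restrict_mem measurableSet_Ioo
    filter_upwards [h1, h2] with q hq1 hq2
    exact (hq1 q.2 ⟨hq2.1.le, hq2.2⟩).comp (tendsto_gridTime hq2)

/-- The occupation measure of the bridge has the density `∫₀ᵗ bridgeMarginal α t x y s z ds`. -/
lemma lintegral_uncurry (h : IsStableBridge α t x y X P) (hα : 0 < α) (ht : 0 < t)
    {f : EuclideanSpace ℝ (Fin d) → ENNReal} (hf : Measurable f) :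
    ∫⁻ q, f (X q.2 q.1) ∂(P.prod (volume.restrict (Ioc 0 t))) =
      ∫⁻ s in Ioc 0 t, ∫⁻ z, ENNReal.ofReal (bridgeMarginal α t x y s z) * f z := by
  have := h.isProbabilityMeasure
  have hfX : AEMeasurable (fun q : Ω × ℝ => f (X q.2 q.1))
      (P.prod (volume.restrict (Ioc 0 t))) := hf.comp_aemeasurable (h.aemeasurable_uncurry ht)
  rw [lintegral_prod_symm _ hfX, ← restrict_Ioo_eq_restrict_Ioc]
  refine setLIntegral_congr_fun measurableSet_Ioo fun s hs => ?_
  simp only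
  have hb : Measurable fun z => ENNReal.ofReal (bridgeMarginal α t x y s z) :=
    ((measurable_bridgeMarginal hα t x y).comp
      (f := fun z : EuclideanSpace ℝ (Fin d) => (s, z)) (by fun_prop)).ennreal_ofReal
  rw [← lintegral_map hf (h.measurable s ⟨hs.1.le, hs.2.le⟩), h.map_apply hs,
    lintegral_withDensity_eq_lintegral_mul _ hb hf]
  rfl

/-- Almost every path spends zero time in a given Lebesgue-null set. -/
lemma ae_ae_of_ae (h : IsStableBridge α t x y X P) (hα : 0 < α) (ht : 0 < t)
    {p : EuclideanSpace ℝ (Fin d) → Prop} (hp : ∀ᵐ z, p z) :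
    ∀ᵐ ω ∂P, ∀ᵐ s ∂(volume.restrict (Ioc 0 t)), p (X s ω) := by
  have := h.isProbabilityMeasure
  obtain ⟨N, hN, hNm, hN0⟩ := exists_measurable_superset_of_null (ae_iff.1 hp)
  have hae : AEMeasurable (fun q : Ω × ℝ => N.indicator (1 : EuclideanSpace ℝ (Fin d) → ENNReal)
      (X q.2 q.1))
      (P.prod (volume.restrict (Ioc 0 t))) :=
    (measurable_one.indicator hNm).comp_aemeasurable (h.aemeasurable_uncurry ht)
  have hL := h.lintegral_uncurry hα ht (measurable_one.indicator hNm)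
  have hz : ∀ᵐ z, z ∉ N := measure_eq_zero_iff_ae_notMem.1 hN0
  have hR : ∫⁻ s in Ioc 0 t, ∫⁻ z, ENNReal.ofReal (bridgeMarginal α t x y s z) *
      N.indicator 1 z = 0 := by
    have : ∀ s, ∫⁻ z, ENNReal.ofReal (bridgeMarginal α t x y s z) * N.indicator 1 z = 0 :=
      fun s => (lintegral_congr_ae (hz.mono fun z hz => by simp [hz])).trans lintegral_zero
    simp [this]
  rw [hR, lintegral_eq_zero_iff' hae] at hL
  refine Measure.ae_ae_of_ae_prod (p := fun q : Ω × ℝ => p (X q.2 q.1)) (hL.mono fun q hq => ?_)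
  by_contra hc
  have : X q.2 q.1 ∈ N := hN hc
  simp [this] at hq

lemma integrable_uncurry (h : IsStableBridge α t x y X P) (ht : 0 < t)
    {V : EuclideanSpace ℝ (Fin d) → ℝ} (hV : Measurable V) {M : ℝ} (hM : ∀ z, |V z| ≤ M) :
    Integrable (fun q : Ω × ℝ => V (X q.2 q.1)) (P.prod (volume.restrict (Ioc 0 t))) := by
  have := h.isProbabilityMeasure
  exact Integrable.of_bound (hV.comp_aemeasurable (h.aemeasurable_uncurry ht)).aestronglyMeasurable
    M (Eventually.of_forall fun q => hM _)

lemma integral_intervalIntegral (h : IsStableBridge α t x y X P) (hα : 0 < α) (ht : 0 < t)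
    (hpos : ∀ s z, 0 < s → 0 < stableDensity (d := d) α s z)
    {V : EuclideanSpace ℝ (Fin d) → ℝ} (hV : Measurable V) {M : ℝ} (hM : ∀ z, |V z| ≤ M) :
    ∫ ω, (∫ s in (0 : ℝ)..t, V (X s ω)) ∂P =
      ∫ s in Ioc 0 t, ∫ z, bridgeMarginal α t x y s z * V z := by
  have := h.isProbabilityMeasure
  simp_rw [intervalIntegral.integral_of_le ht.le]
  rw [integral_integral_swap (h.integrable_uncurry ht hV hM), ← restrict_Ioo_eq_restrict_Ioc]
  refine setIntegral_congr_fun measurableSet_Ioo fun s hs => ?_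
  have hb : Measurable fun z => bridgeMarginal α t x y s z :=
    ((measurable_bridgeMarginal hα t x y).comp
      (f := fun z : EuclideanSpace ℝ (Fin d) => (s, z)) (by fun_prop))
  rw [← integral_map (h.measurable s ⟨hs.1.le, hs.2.le⟩).aemeasurable
    hV.aestronglyMeasurable, h.map_apply hs,
    integral_withDensity_eq_integral_toReal_smul hb.ennreal_ofReal
      (Eventually.of_forall fun _ => ENNReal.ofReal_lt_top)]
  refine integral_congr_ae (Eventually.of_forall fun z => ?_)
  have : 0 ≤ bridgeMarginal α t x y s z :=
    div_nonneg (mul_nonneg (hpos _ _ hs.1).le (hpos _ _ (sub_pos.2 hs.2)).le) (hpos _ _ ht).le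
  simp only [ENNReal.toReal_ofReal this, smul_eq_mul]

end IsStableBridge

/-! ### Measurable dependence of finite-dimensional expectations on the end points -/

lemma measurable_bridgeDensity {d : ℕ} {α : ℝ} (hα : 0 < α) (t : ℝ) {k : ℕ} (s : Fin k → ℝ) :
    Measurable fun q : (EuclideanSpace ℝ (Fin d) × EuclideanSpace ℝ (Fin d)) ×
      (Fin k → EuclideanSpace ℝ (Fin d)) => bridgeDensity α t q.1.1 q.1.2 s q.2 := by
  have hp : ∀ c, Measurable (stableDensity (d := d) α c) := fun c =>
    (measurable_stableDensity (d := d) hα).comp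
      (f := fun z : EuclideanSpace ℝ (Fin d) => (c, z)) (by fun_prop)
  have hw : ∀ j : Fin (k + 2), Measurable fun q : (EuclideanSpace ℝ (Fin d) ×
      EuclideanSpace ℝ (Fin d)) × (Fin k → EuclideanSpace ℝ (Fin d)) =>
      (Fin.cons (α := fun _ => EuclideanSpace ℝ (Fin d)) q.1.1
        (Fin.snoc (α := fun _ => EuclideanSpace ℝ (Fin d)) q.2 q.1.2) :
          Fin (k + 2) → EuclideanSpace ℝ (Fin d)) j := by
    intro j
    induction j using Fin.cases with
    | zero =>
      simp only [Fin.cons_zero]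
      exact measurable_fst.comp measurable_fst
    | succ j =>
      simp only [Fin.cons_succ]
      induction j using Fin.lastCases with
      | last =>
        simp only [Fin.snoc_last]
        exact measurable_snd.comp measurable_fst
      | cast j =>
        simp only [Fin.snoc_castSucc]
        exact (measurable_pi_apply j).comp measurable_snd
  unfold bridgeDensity
  refine Measurable.div (Finset.measurable_fun_prod _ fun j _ => ?_) ?_
  · exact (hp _).comp ((hw _).sub (hw _))
  · exact (hp _).comp (by fun_prop)

/-- Expectations of functionals of finitely many positions of the bridge depend measurably on its
end points, because the joint densities do. -/
lemma stronglyMeasurable_integral_comp_bridge {d : ℕ} {Ω : Type*} [MeasurableSpace Ω] {α t : ℝ}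
    (hα : 0 < α) {X : ℝ → Ω → EuclideanSpace ℝ (Fin d)}
    {P : EuclideanSpace ℝ (Fin d) → EuclideanSpace ℝ (Fin d) → Measure Ω}
    (h : ∀ x y, IsStableBridge α t x y X (P x y)) {k : ℕ} {s : Fin k → ℝ} (hs : StrictMono s)
    (hst : ∀ i, s i ∈ Ioo 0 t) {G : (Fin k → EuclideanSpace ℝ (Fin d)) → ℝ} (hG : Measurable G) :
    StronglyMeasurable fun p : EuclideanSpace ℝ (Fin d) × EuclideanSpace ℝ (Fin d) =>
      ∫ ω, G (fun i => X (s i) ω) ∂(P p.1 p.2) := by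
  have hb := measurable_bridgeDensity (d := d) hα t s
  have heq : (fun p : EuclideanSpace ℝ (Fin d) × EuclideanSpace ℝ (Fin d) =>
      ∫ ω, G (fun i => X (s i) ω) ∂(P p.1 p.2)) = fun p =>
      ∫ z, (ENNReal.ofReal (bridgeDensity α t p.1 p.2 s z)).toReal • G z := by
    ext p
    have hm : Measurable fun (ω : Ω) (i : Fin k) => X (s i) ω :=
      measurable_pi_lambda _ fun i =>
        (h p.1 p.2).measurable _ ⟨(hst i).1.le, (hst i).2.le⟩
    rw [← integral_map hm.aemeasurable hG.aestronglyMeasurable,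
      (h p.1 p.2).finite_dimensional k s hs hst,
      integral_withDensity_eq_integral_toReal_smul _
        (Eventually.of_forall fun _ => ENNReal.ofReal_lt_top)]
    exact (hb.comp (f := fun z : Fin k → EuclideanSpace ℝ (Fin d) => (p, z))
      (by fun_prop)).ennreal_ofReal
  rw [heq]
  refine StronglyMeasurable.integral_prod_right' (f := fun q : (EuclideanSpace ℝ (Fin d) ×
      EuclideanSpace ℝ (Fin d)) × (Fin k → EuclideanSpace ℝ (Fin d)) =>
      (ENNReal.ofReal (bridgeDensity α t q.1.1 q.1.2 s q.2)).toReal • G q.2) ?_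
  exact (hb.ennreal_ofReal.ennreal_toReal.smul (hG.comp measurable_snd)).stronglyMeasurable

/-! ### Measurability of the Feynman–Kac functional -/

/-- The value at time `s` of the right-end-point step approximation of `V` along a path that visits
`z k` at time `t (k + 1) / (n + 1)`; it is put equal to `0` on the last cell, whose right end point
is the terminal time. -/
noncomputable def stepFun {E : Type*} (V : E → ℝ) (t : ℝ) (n : ℕ) (z : Fin n → E) (s : ℝ) : ℝ :=
  ∑ k : Fin n, if ⌊s * (n + 1) / t⌋₊ = (k : ℕ) then V (z k) else 0

lemma stepFun_of_lt {E : Type*} (V : E → ℝ) {t s : ℝ} {n : ℕ} (z : Fin n → E)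
    (h : ⌊s * (n + 1) / t⌋₊ < n) : stepFun V t n z s = V (z ⟨_, h⟩) := by
  unfold stepFun
  rw [Finset.sum_eq_single ⟨_, h⟩]
  · simp
  · intro k _ hk
    exact if_neg fun h' => hk (Fin.ext h'.symm)
  · simp

lemma abs_stepFun_le {E : Type*} {V : E → ℝ} {M : ℝ} (hM0 : 0 ≤ M) (hM : ∀ z, |V z| ≤ M)
    (t : ℝ) (n : ℕ) (z : Fin n → E) (s : ℝ) : |stepFun V t n z s| ≤ M := by
  by_cases h : ⌊s * (n + 1) / t⌋₊ < n
  · rw [stepFun_of_lt V z h]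
    exact hM _
  · have : stepFun V t n z s = 0 :=
      Finset.sum_eq_zero fun k _ => if_neg fun h' => h (h'.trans_lt k.2)
    simpa [this] using hM0

lemma measurable_stepFun {E : Type*} [MeasurableSpace E] {V : E → ℝ} (hV : Measurable V) (t : ℝ)
    (n : ℕ) : Measurable fun q : (Fin n → E) × ℝ => stepFun V t n q.1 q.2 := by
  unfold stepFun
  refine Finset.measurable_fun_sum _ fun k _ => Measurable.ite ?_ ?_ measurable_const
  · have : Measurable fun q : (Fin n → E) × ℝ => ⌊q.2 * (n + 1) / t⌋₊ :=
      Nat.measurable_floor.comp (by fun_prop)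
    exact this (measurableSet_singleton _)
  · exact hV.comp ((measurable_pi_apply k).comp measurable_fst)

/-- Along a right-continuous path the step approximation of a continuous function converges. -/
lemma tendsto_stepFun {E : Type*} [TopologicalSpace E] {V : E → ℝ} (hV : Continuous V) {t s : ℝ}
    (hs : s ∈ Ioo 0 t) {γ : ℝ → E} (hγ : Tendsto γ (𝓝[>] s) (𝓝 (γ s))) :
    Tendsto (fun n : ℕ => stepFun V t n (fun k => γ (t * ((k : ℝ) + 1) / (n + 1))) s) atTop
      (𝓝 (V (γ s))) := by
  have ht : 0 < t := hs.1.trans hs.2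
  refine (((hV.tendsto _).comp hγ).comp (tendsto_gridTime hs)).congr' ?_
  filter_upwards [eventually_gt_atTop ⌈s / (t - s)⌉₊] with n hn
  have hn' : s / (t - s) < n := (Nat.le_ceil _).trans_lt (by exact_mod_cast hn)
  rw [div_lt_iff₀ (sub_pos.2 hs.2)] at hn'
  have hlt : ⌊s * ((n : ℝ) + 1) / t⌋₊ < n := by
    rw [Nat.floor_lt (div_nonneg (mul_nonneg hs.1.le (by positivity)) ht.le), div_lt_iff₀ ht]
    linarith
  rw [stepFun_of_lt V _ hlt]
  have hle : (⌊s * ((n : ℝ) + 1) / t⌋₊ : ℝ) ≤ n := by exact_mod_cast hlt.le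
  have : gridTime t n s = t * ((⌊s * ((n : ℝ) + 1) / t⌋₊ : ℝ) + 1) / (n + 1) := by
    unfold gridTime
    push_cast
    refine min_eq_left ?_
    rw [div_le_iff₀ (by positivity)]
    gcongr
  simp only [Function.comp_apply, this]

/-- The Feynman–Kac functional `∫ exp (-∫₀ᵗ V (X_s) ds) dP`. -/
noncomputable def feynmanKac {E Ω : Type*} [MeasurableSpace Ω] (X : ℝ → Ω → E) (t : ℝ) (V : E → ℝ)
    (P : Measure Ω) : ℝ :=
  ∫ ω, Real.exp (-∫ s in (0 : ℝ)..t, V (X s ω)) ∂P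

lemma abs_integral_path_le {E : Type*} {V : E → ℝ} {M t : ℝ} (ht : 0 < t)
    (hM : ∀ z, |V z| ≤ M) (γ : ℝ → E) : |∫ s in (0 : ℝ)..t, V (γ s)| ≤ t * M := by
  have := intervalIntegral.norm_integral_le_of_norm_le_const (a := 0) (b := t)
    (f := fun s => V (γ s)) (C := M) fun s _ => hM _
  rwa [Real.norm_eq_abs, sub_zero, abs_of_pos ht, mul_comm] at this

namespace IsStableBridge

variable {d : ℕ} {Ω : Type*} [MeasurableSpace Ω] {α t : ℝ} {x y : EuclideanSpace ℝ (Fin d)}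
  {X : ℝ → Ω → EuclideanSpace ℝ (Fin d)} {P : Measure Ω}

lemma integrable_intervalIntegral (h : IsStableBridge α t x y X P) (ht : 0 < t)
    {V : EuclideanSpace ℝ (Fin d) → ℝ} (hV : Measurable V) {M : ℝ} (hM : ∀ z, |V z| ≤ M) :
    Integrable (fun ω => ∫ s in (0 : ℝ)..t, V (X s ω)) P := by
  have := h.isProbabilityMeasure
  simp_rw [intervalIntegral.integral_of_le ht.le]
  exact (h.integrable_uncurry ht hV hM).integral_prod_left

lemma integrable_exp (h : IsStableBridge α t x y X P) (ht : 0 < t)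
    {V : EuclideanSpace ℝ (Fin d) → ℝ} (hV : Measurable V) {M : ℝ} (hM : ∀ z, |V z| ≤ M) :
    Integrable (fun ω => Real.exp (-∫ s in (0 : ℝ)..t, V (X s ω))) P := by
  have := h.isProbabilityMeasure
  refine Integrable.of_bound (Real.continuous_exp.comp_aestronglyMeasurable
    (h.integrable_intervalIntegral ht hV hM).aestronglyMeasurable.neg) (Real.exp (t * M))
    (Eventually.of_forall fun ω => ?_)
  rw [Real.norm_eq_abs, Real.abs_exp, Real.exp_le_exp]
  exact (neg_le_abs _).trans (abs_integral_path_le ht hM _)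

/-- Dominated convergence, first along the paths and then over the paths. -/
lemma tendsto_feynmanKac (h : IsStableBridge α t x y X P) (hα : 0 < α) (ht : 0 < t)
    {V : EuclideanSpace ℝ (Fin d) → ℝ} {U : ℕ → EuclideanSpace ℝ (Fin d) → ℝ}
    (hU : ∀ n, Measurable (U n)) {M : ℝ} (hM : ∀ n z, |U n z| ≤ M)
    (hlim : ∀ᵐ z, Tendsto (fun n => U n z) atTop (𝓝 (V z))) :
    Tendsto (fun n => feynmanKac X t (U n) P) atTop (𝓝 (feynmanKac X t V P)) := by
  have := h.isProbabilityMeasure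
  refine tendsto_integral_of_dominated_convergence (fun _ => Real.exp (t * M))
    (fun n => (h.integrable_exp ht (hU n) (hM n)).aestronglyMeasurable) (integrable_const _)
    (fun n => Eventually.of_forall fun ω => ?_) ?_
  · rw [Real.norm_eq_abs, Real.abs_exp, Real.exp_le_exp]
    exact (neg_le_abs _).trans (abs_integral_path_le ht (hM n) _)
  · have hm : ∀ᵐ ω ∂P, ∀ n, Integrable (fun s => U n (X s ω)) (volume.restrict (Ioc 0 t)) :=
      ae_all_iff.2 fun n => (h.integrable_uncurry ht (hU n) (hM n)).prod_right_ae
    filter_upwards [hm, h.ae_ae_of_ae hα ht hlim] with ω h1 h2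
    refine (Real.continuous_exp.tendsto _).comp (Tendsto.neg ?_)
    simp_rw [intervalIntegral.integral_of_le ht.le]
    exact tendsto_integral_of_dominated_convergence (fun _ => M)
      (fun n => (h1 n).aestronglyMeasurable) (integrable_const _)
      (fun n => Eventually.of_forall fun s => hM n _) h2

/-- For continuous `V` the Feynman–Kac functional is a limit of expectations of functionals of
finitely many positions. -/
lemma tendsto_integral_exp_stepFun (h : IsStableBridge α t x y X P) (ht : 0 < t)
    {V : EuclideanSpace ℝ (Fin d) → ℝ} (hV : Continuous V) {M : ℝ} (hM0 : 0 ≤ M)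
    (hM : ∀ z, |V z| ≤ M) :
    Tendsto (fun n : ℕ => ∫ ω, Real.exp (-∫ s in Ioc 0 t,
      stepFun V t n (fun k => X (t * ((k : ℝ) + 1) / (n + 1)) ω) s) ∂P) atTop
      (𝓝 (feynmanKac X t V P)) := by
  have := h.isProbabilityMeasure
  refine tendsto_integral_of_dominated_convergence (fun _ => Real.exp (t * M))
    (fun n => ?_) (integrable_const _) (fun n => Eventually.of_forall fun ω => ?_) ?_
  · have h1 : StronglyMeasurable fun z : Fin n → EuclideanSpace ℝ (Fin d) =>
        ∫ s in Ioc 0 t, stepFun V t n z s :=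
      (measurable_stepFun hV.measurable t n).stronglyMeasurable.integral_prod_right'
    have h2 : Measurable fun (ω : Ω) (k : Fin n) => X (t * ((k : ℝ) + 1) / (n + 1)) ω := by
      refine measurable_pi_lambda _ fun k => h.measurable _ ⟨by positivity, ?_⟩
      rw [div_le_iff₀ (by positivity)]
      have : ((k : ℕ) : ℝ) ≤ n := by exact_mod_cast k.2.le
      gcongr
    exact (Real.measurable_exp.comp (h1.measurable.comp h2).neg).aestronglyMeasurable
  · rw [Real.norm_eq_abs, Real.abs_exp, Real.exp_le_exp]
    refine (neg_le_abs _).trans ?_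
    rw [← intervalIntegral.integral_of_le ht.le]
    exact abs_integral_path_le (E := ℝ) ht (abs_stepFun_le hM0 hM t n _) id
  · filter_upwards [h.right_continuous] with ω hω
    refine (Real.continuous_exp.tendsto _).comp (Tendsto.neg ?_)
    rw [intervalIntegral.integral_of_le ht.le]
    refine tendsto_integral_of_dominated_convergence (fun _ => M) (fun n => ?_)
      (integrable_const _) (fun n => Eventually.of_forall fun s => abs_stepFun_le hM0 hM t n _ s) ?_
    · exact ((measurable_stepFun hV.measurable t n).comp
        (f := fun s : ℝ => ((fun k : Fin n => X (t * ((k : ℝ) + 1) / (n + 1)) ω), s))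
        (by fun_prop)).aestronglyMeasurable
    · rw [← restrict_Ioo_eq_restrict_Ioc]
      filter_upwards [ae_restrict_mem measurableSet_Ioo] with s hs
      exact tendsto_stepFun hV hs (γ := fun s => X s ω) (hω s ⟨hs.1.le, hs.2⟩)

end IsStableBridge

lemma stronglyMeasurable_feynmanKac_of_continuous {d : ℕ} {Ω : Type*} [MeasurableSpace Ω] {α t : ℝ}
    (hα : 0 < α) (ht : 0 < t) {X : ℝ → Ω → EuclideanSpace ℝ (Fin d)}
    {P : EuclideanSpace ℝ (Fin d) → EuclideanSpace ℝ (Fin d) → Measure Ω}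
    (h : ∀ x y, IsStableBridge α t x y X (P x y))
    {V : EuclideanSpace ℝ (Fin d) → ℝ} (hV : Continuous V) {M : ℝ} (hM0 : 0 ≤ M)
    (hM : ∀ z, |V z| ≤ M) :
    StronglyMeasurable fun p : EuclideanSpace ℝ (Fin d) × EuclideanSpace ℝ (Fin d) =>
      feynmanKac X t V (P p.1 p.2) := by
  refine stronglyMeasurable_of_tendsto atTop (f := fun (n : ℕ) p => ∫ ω, Real.exp (-∫ s in Ioc 0 t,
      stepFun V t n (fun k => X (t * ((k : ℝ) + 1) / (n + 1)) ω) s) ∂(P p.1 p.2)) (fun n => ?_)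
    (tendsto_pi_nhds.2 fun p => (h p.1 p.2).tendsto_integral_exp_stepFun ht hV hM0 hM)
  have h1 : StronglyMeasurable fun z : Fin n → EuclideanSpace ℝ (Fin d) =>
      ∫ s in Ioc 0 t, stepFun V t n z s :=
    (measurable_stepFun hV.measurable t n).stronglyMeasurable.integral_prod_right'
  refine stronglyMeasurable_integral_comp_bridge hα h
    (s := fun k : Fin n => t * ((k : ℝ) + 1) / (n + 1)) (fun i j hij => ?_)
    (fun k => ⟨by positivity, ?_⟩)
    (G := fun z => Real.exp (-∫ s in Ioc 0 t, stepFun V t n z s))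
    (Real.measurable_exp.comp h1.measurable.neg)
  · have : ((i : ℕ) : ℝ) < (j : ℕ) := by exact_mod_cast hij
    simp only
    gcongr
  · rw [div_lt_iff₀ (by positivity)]
    have : ((k : ℕ) : ℝ) < n := by exact_mod_cast k.2
    gcongr

lemma exists_continuous_bounded_tendsto_ae {d : ℕ} {V : EuclideanSpace ℝ (Fin d) → ℝ}
    (hV : Integrable V) {M : ℝ} (hM0 : 0 ≤ M) (hM : ∀ z, |V z| ≤ M) :
    ∃ U : ℕ → EuclideanSpace ℝ (Fin d) → ℝ, (∀ n, Continuous (U n)) ∧ (∀ n z, |U n z| ≤ M) ∧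
      ∀ᵐ z, Tendsto (fun n => U n z) atTop (𝓝 (V z)) := by
  have hex : ∀ n : ℕ, ∃ g : BoundedContinuousFunction (EuclideanSpace ℝ (Fin d)) ℝ,
      eLpNorm (V - ⇑g) 1 volume ≤ ENNReal.ofReal (1 / ((n : ℝ) + 1)) ∧ MemLp g 1 volume :=
    fun n => (memLp_one_iff_integrable.2 hV).exists_boundedContinuous_eLpNorm_sub_le
      ENNReal.one_ne_top (by
        rw [Ne, ENNReal.ofReal_eq_zero, not_le]
        positivity)
  choose g hg hgm using hex
  have h0 : Tendsto (fun n => eLpNorm (⇑(g n) - V) 1 volume) atTop (𝓝 0) := by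
    have h1 : Tendsto (fun n : ℕ => ENNReal.ofReal (1 / ((n : ℝ) + 1))) atTop (𝓝 0) := by
      simpa using ENNReal.tendsto_ofReal (tendsto_one_div_add_atTop_nhds_zero_nat (𝕜 := ℝ))
    refine tendsto_of_tendsto_of_tendsto_of_le_of_le tendsto_const_nhds h1
      (fun _ => zero_le) fun n => ?_
    rw [eLpNorm_sub_comm]
    exact hg n
  obtain ⟨ns, -, hns⟩ := (tendstoInMeasure_of_tendsto_eLpNorm one_ne_zero
    (fun n => (g n).continuous.aestronglyMeasurable) hV.aestronglyMeasurable
    h0).exists_seq_tendsto_ae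
  refine ⟨fun n z => max (-M) (min M (g (ns n) z)), fun n => ?_, fun n z => ?_, ?_⟩
  · have := (g (ns n)).continuous
    fun_prop
  · exact abs_le.2 ⟨le_max_left _ _, max_le (by linarith) (min_le_left _ _)⟩
  · filter_upwards [hns] with z hz
    have hVz := abs_le.1 (hM z)
    have : V z = max (-M) (min M (V z)) := by
      rw [min_eq_right hVz.2, max_eq_right hVz.1]
    rw [this]
    exact tendsto_const_nhds.max (tendsto_const_nhds.min hz)

lemma stronglyMeasurable_feynmanKac {d : ℕ} {Ω : Type*} [MeasurableSpace Ω] {α t : ℝ}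
    (hα : 0 < α) (ht : 0 < t) {X : ℝ → Ω → EuclideanSpace ℝ (Fin d)}
    {P : EuclideanSpace ℝ (Fin d) → EuclideanSpace ℝ (Fin d) → Measure Ω}
    (h : ∀ x y, IsStableBridge α t x y X (P x y))
    {V : EuclideanSpace ℝ (Fin d) → ℝ} (hV : Integrable V) {M : ℝ} (hM0 : 0 ≤ M)
    (hM : ∀ z, |V z| ≤ M) :
    StronglyMeasurable fun p : EuclideanSpace ℝ (Fin d) × EuclideanSpace ℝ (Fin d) =>
      feynmanKac X t V (P p.1 p.2) := by
  obtain ⟨U, hUc, hUM, hlim⟩ := exists_continuous_bounded_tendsto_ae hV hM0 hM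
  exact stronglyMeasurable_of_tendsto atTop
    (fun n => stronglyMeasurable_feynmanKac_of_continuous hα ht h (hUc n) hM0 (hUM n))
    (tendsto_pi_nhds.2 fun p =>
      (h p.1 p.2).tendsto_feynmanKac hα ht (fun n => (hUc n).measurable) hUM hlim)

/-! ### The second-order remainder of the exponential -/

lemma exp_sub_one_sub_le_of_nonneg {b : ℝ} (hb : 0 ≤ b) :
    Real.exp b - 1 - b ≤ 1 / 2 * b ^ 2 * Real.exp b := by
  have hmono : MonotoneOn (fun b : ℝ => 1 / 2 * b ^ 2 * Real.exp b - (Real.exp b - 1 - b))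
      (Ici 0) := by
    have hder : ∀ c : ℝ, HasDerivAt
        (fun b : ℝ => 1 / 2 * b ^ 2 * Real.exp b - (Real.exp b - 1 - b))
        (1 / 2 * (2 * c) * Real.exp c + 1 / 2 * c ^ 2 * Real.exp c - (Real.exp c - 1)) c := by
      intro c
      have h1 : HasDerivAt (fun b : ℝ => 1 / 2 * b ^ 2) (1 / 2 * (2 * c)) c := by
        simpa using (hasDerivAt_pow 2 c).const_mul (1 / 2 : ℝ)
      exact (h1.mul (Real.hasDerivAt_exp c)).sub
        (((Real.hasDerivAt_exp c).sub_const 1).sub (hasDerivAt_id c))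
    refine monotoneOn_of_hasDerivWithinAt_nonneg (convex_Ici 0)
      (fun c _ => (hder c).continuousAt.continuousWithinAt)
      (fun c _ => (hder c).hasDerivWithinAt) fun c hc => ?_
    have h2 := Real.add_one_le_exp (-c)
    have h3 : Real.exp (-c) * Real.exp c = 1 := by rw [← Real.exp_add]; simp
    nlinarith [mul_le_mul_of_nonneg_right h2 (Real.exp_pos c).le,
      mul_nonneg (sq_nonneg c) (Real.exp_pos c).le]
  have := hmono (mem_Ici.2 le_rfl) hb hb
  simp only [Real.exp_zero] at this
  linarith

lemma abs_exp_neg_sub_one_add_le (a : ℝ) :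
    |Real.exp (-a) - 1 + a| ≤ 1 / 2 * a ^ 2 * Real.exp |a| := by
  have h := Complex.norm_exp_sub_sum_le_exp_norm_sub_sum (((-a : ℝ)) : ℂ) 2
  simp only [Finset.sum_range_succ, Finset.range_zero, Finset.sum_empty, zero_add, pow_zero,
    Nat.factorial_zero, Nat.cast_one, div_one, pow_one, Nat.factorial_one,
    Complex.norm_real, norm_neg, Real.norm_eq_abs] at h
  rw [← Complex.ofReal_exp, ← Complex.ofReal_one, ← Complex.ofReal_add, ← Complex.ofReal_sub,
    Complex.norm_real, Real.norm_eq_abs] at h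
  have h2 := exp_sub_one_sub_le_of_nonneg (abs_nonneg a)
  rw [sq_abs] at h2
  have h3 : Real.exp (-a) - 1 + a = Real.exp (-a) - (1 + -a) := by ring
  rw [h3]
  linarith

/-- The second-order remainder of the Feynman–Kac exponential along a path, bounded linearly in
`|V|` so that only a first moment remains to be computed. -/
lemma abs_exp_path_sub_le {E : Type*} {V : E → ℝ} {M t : ℝ} (ht : 0 < t)
    (hM : ∀ z, |V z| ≤ M) (γ : ℝ → E) :
    |Real.exp (-∫ s in (0 : ℝ)..t, V (γ s)) - 1 + ∫ s in (0 : ℝ)..t, V (γ s)| ≤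
      1 / 2 * t * M * Real.exp (t * M) * ∫ s in (0 : ℝ)..t, |V (γ s)| := by
  set a := ∫ s in (0 : ℝ)..t, V (γ s)
  have h1 : |a| ≤ t * M := abs_integral_path_le ht hM γ
  have h2 : |a| ≤ ∫ s in (0 : ℝ)..t, |V (γ s)| :=
    intervalIntegral.abs_integral_le_integral_abs ht.le
  calc _ ≤ 1 / 2 * a ^ 2 * Real.exp |a| := abs_exp_neg_sub_one_add_le a
    _ = 1 / 2 * (|a| * |a|) * Real.exp |a| := by rw [← sq_abs, sq]
    _ ≤ 1 / 2 * ((t * M) * ∫ s in (0 : ℝ)..t, |V (γ s)|) * Real.exp (t * M) := by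
      have := mul_le_mul h1 h2 (abs_nonneg a) ((abs_nonneg a).trans h1)
      have := mul_nonneg ((abs_nonneg a).trans h1) ((abs_nonneg a).trans h2)
      gcongr
    _ = _ := by ring

/-! ### The first moment -/

/-- The density of paths from `x` to `y` through `z` at time `s`, weighted by `U z`; the argument is
`((x, y), (s, z))`. -/
noncomputable def throughKernel {d : ℕ} (α t : ℝ) (U : EuclideanSpace ℝ (Fin d) → ℝ)
    (q : (EuclideanSpace ℝ (Fin d) × EuclideanSpace ℝ (Fin d)) ×
      (ℝ × EuclideanSpace ℝ (Fin d))) : ℝ :=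
  U q.2.2 * (stableDensity α q.2.1 (q.1.1 - q.2.2) * stableDensity α (t - q.2.1) (q.2.2 - q.1.2))

lemma measurable_throughKernel {d : ℕ} {α : ℝ} (hα : 0 < α) (t : ℝ)
    {U : EuclideanSpace ℝ (Fin d) → ℝ} (hU : Measurable U) :
    Measurable (throughKernel α t U) := by
  have hm := measurable_stableDensity (d := d) hα
  unfold throughKernel
  refine Measurable.mul (by fun_prop) (Measurable.mul ?_ ?_)
  · exact hm.comp (f := fun q : (EuclideanSpace ℝ (Fin d) × EuclideanSpace ℝ (Fin d)) ×
      (ℝ × EuclideanSpace ℝ (Fin d)) => (q.2.1, q.1.1 - q.2.2)) (by fun_prop)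
  · exact hm.comp (f := fun q : (EuclideanSpace ℝ (Fin d) × EuclideanSpace ℝ (Fin d)) ×
      (ℝ × EuclideanSpace ℝ (Fin d)) => (t - q.2.1, q.2.2 - q.1.2)) (by fun_prop)

section ThroughKernel

variable {d : ℕ} {α t : ℝ} {U : EuclideanSpace ℝ (Fin d) → ℝ}

lemma integrable_throughKernel_left (hd : 1 ≤ d) (hα : 0 < α)
    (hpos : ∀ s z, 0 < s → 0 < stableDensity (d := d) α s z) {s : ℝ} (hs : s ∈ Ioo 0 t)
    (z : EuclideanSpace ℝ (Fin d)) :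
    Integrable (fun p => throughKernel α t U (p, (s, z))) (volume.prod volume) := by
  have h1 := (integrable_stableDensity hd hα hs.1 fun z => hpos s z hs.1).comp_sub_right z
  have hts := sub_pos.2 hs.2
  have h2 := (integrable_stableDensity hd hα hts fun z => hpos _ z hts).comp_sub_left z
  exact (h1.mul_prod h2).const_mul (U z)

lemma integral_throughKernel_left (hd : 1 ≤ d) (hα : 0 < α)
    (hpos : ∀ s z, 0 < s → 0 < stableDensity (d := d) α s z) {s : ℝ} (hs : s ∈ Ioo 0 t)
    (z : EuclideanSpace ℝ (Fin d)) :
    ∫ p, throughKernel α t U (p, (s, z)) ∂(volume.prod volume) = U z := by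
  have hts := sub_pos.2 hs.2
  simp only [throughKernel]
  rw [integral_const_mul, integral_prod_mul (fun x => stableDensity α s (x - z))
    (fun y => stableDensity α (t - s) (z - y)), integral_sub_right_eq_self (stableDensity α s) z,
    integral_sub_left_eq_self (stableDensity α (t - s)) volume z,
    integral_stableDensity hd hα hs.1 fun z => hpos s z hs.1,
    integral_stableDensity hd hα hts fun z => hpos _ z hts]
  simp

lemma norm_throughKernel (hpos : ∀ s z, 0 < s → 0 < stableDensity (d := d) α s z) {s : ℝ}
    (hs : s ∈ Ioo 0 t) (z : EuclideanSpace ℝ (Fin d))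
    (p : EuclideanSpace ℝ (Fin d) × EuclideanSpace ℝ (Fin d)) :
    ‖throughKernel α t U (p, (s, z))‖ = throughKernel α t (fun z => |U z|) (p, (s, z)) := by
  simp only [throughKernel, Real.norm_eq_abs]
  rw [abs_mul, abs_of_pos (mul_pos (hpos _ _ hs.1) (hpos _ _ (sub_pos.2 hs.2)))]

lemma ae_fst_mem_Ioo (t : ℝ) {E : Type*} [MeasurableSpace E] (ν : Measure E) [SFinite ν] :
    ∀ᵐ r ∂((volume.restrict (Ioc 0 t)).prod ν), r.1 ∈ Ioo 0 t := by
  refine Measure.quasiMeasurePreserving_fst.ae ?_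
  rw [← restrict_Ioo_eq_restrict_Ioc]
  exact ae_restrict_mem measurableSet_Ioo

lemma integrable_throughKernel (hd : 1 ≤ d) (hα : 0 < α)
    (hpos : ∀ s z, 0 < s → 0 < stableDensity (d := d) α s z) (hUm : Measurable U)
    (hU : Integrable U) :
    Integrable (throughKernel α t U)
      ((volume.prod volume).prod ((volume.restrict (Ioc 0 t)).prod volume)) := by
  rw [integrable_prod_iff' (measurable_throughKernel hα t hUm).aestronglyMeasurable]
  have hs := ae_fst_mem_Ioo t (volume : Measure (EuclideanSpace ℝ (Fin d)))
  refine ⟨hs.mono fun r hr => integrable_throughKernel_left hd hα hpos hr r.2, ?_⟩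
  refine (hU.abs.comp_snd (volume.restrict (Ioc 0 t))).congr (hs.mono fun r hr => ?_)
  simp_rw [norm_throughKernel hpos hr]
  exact (integral_throughKernel_left (U := fun z => |U z|) hd hα hpos hr r.2).symm

lemma integral_throughKernel (hd : 1 ≤ d) (hα : 0 < α) (ht : 0 < t)
    (hpos : ∀ s z, 0 < s → 0 < stableDensity (d := d) α s z) (hUm : Measurable U)
    (hU : Integrable U) :
    ∫ q, throughKernel α t U q
      ∂((volume.prod volume).prod ((volume.restrict (Ioc 0 t)).prod volume)) = t * ∫ z, U z := by
  have hs := ae_fst_mem_Ioo t (volume : Measure (EuclideanSpace ℝ (Fin d)))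
  rw [integral_prod_symm _ (integrable_throughKernel hd hα hpos hUm hU),
    integral_congr_ae (hs.mono fun r hr => integral_throughKernel_left hd hα hpos hr r.2),
    integral_fun_snd]
  simp [ht.le]

end ThroughKernel

section FirstMoment

variable {d : ℕ} {Ω : Type*} [MeasurableSpace Ω] {α t : ℝ} {X : ℝ → Ω → EuclideanSpace ℝ (Fin d)}
  {P : EuclideanSpace ℝ (Fin d) → EuclideanSpace ℝ (Fin d) → Measure Ω}
  {U : EuclideanSpace ℝ (Fin d) → ℝ} {M : ℝ}

lemma firstMoment_ae_eq (hd : 1 ≤ d) (hα : 0 < α) (ht : 0 < t)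
    (hpos : ∀ s z, 0 < s → 0 < stableDensity (d := d) α s z)
    (h : ∀ x y, IsStableBridge α t x y X (P x y)) (hUm : Measurable U) (hU : Integrable U)
    (hM : ∀ z, |U z| ≤ M) :
    (fun p => ∫ r, throughKernel α t U (p, r) ∂((volume.restrict (Ioc 0 t)).prod volume))
      =ᵐ[volume.prod volume] fun p => stableDensity α t (p.1 - p.2) *
      ∫ ω, (∫ s in (0 : ℝ)..t, U (X s ω)) ∂(P p.1 p.2) := by
  filter_upwards [(integrable_throughKernel (t := t) hd hα hpos hUm hU).prod_right_ae] with p hp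
  rw [integral_prod _ hp, (h p.1 p.2).integral_intervalIntegral hα ht hpos hUm hM,
    ← integral_const_mul]
  congr with s
  rw [← integral_const_mul]
  congr with z
  have := (hpos t (p.1 - p.2) ht).ne'
  simp only [throughKernel, bridgeMarginal]
  field_simp

lemma integrable_firstMoment (hd : 1 ≤ d) (hα : 0 < α) (ht : 0 < t)
    (hpos : ∀ s z, 0 < s → 0 < stableDensity (d := d) α s z)
    (h : ∀ x y, IsStableBridge α t x y X (P x y)) (hUm : Measurable U) (hU : Integrable U)
    (hM : ∀ z, |U z| ≤ M) :
    Integrable (fun p => stableDensity α t (p.1 - p.2) *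
      ∫ ω, (∫ s in (0 : ℝ)..t, U (X s ω)) ∂(P p.1 p.2)) (volume.prod volume) :=
  (integrable_throughKernel hd hα hpos hUm hU).integral_prod_left.congr
    (firstMoment_ae_eq hd hα ht hpos h hUm hU hM)

/-- The first moment `∫∫ p_t(x, y) E_{x,y}[∫₀ᵗ U(X_s) ds] dx dy` is `t ∫ U`: by Tonelli one may
integrate first over the end points, and `p_s` and `p_{t-s}` have integral `1`. -/
lemma integral_firstMoment (hd : 1 ≤ d) (hα : 0 < α) (ht : 0 < t)
    (hpos : ∀ s z, 0 < s → 0 < stableDensity (d := d) α s z)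
    (h : ∀ x y, IsStableBridge α t x y X (P x y)) (hUm : Measurable U) (hU : Integrable U)
    (hM : ∀ z, |U z| ≤ M) :
    ∫ p, stableDensity α t (p.1 - p.2) *
      ∫ ω, (∫ s in (0 : ℝ)..t, U (X s ω)) ∂(P p.1 p.2) ∂(volume.prod volume) = t * ∫ z, U z := by
  rw [← integral_congr_ae (firstMoment_ae_eq hd hα ht hpos h hUm hU hM),
    ← integral_prod _ (integrable_throughKernel hd hα hpos hUm hU),
    integral_throughKernel hd hα ht hpos hUm hU]

end FirstMoment

/-! ### The heat content -/

section HeatContent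

variable {d : ℕ} {Ω : Type*} [MeasurableSpace Ω] {α t : ℝ} {X : ℝ → Ω → EuclideanSpace ℝ (Fin d)}
  {P : ℝ → EuclideanSpace ℝ (Fin d) → EuclideanSpace ℝ (Fin d) → Measure Ω}
  {V : EuclideanSpace ℝ (Fin d) → ℝ} {M : ℝ}

/-- The remainder of `p_t^{H_V} - p_t` after its first-order term, as an expectation. -/
lemma schrodingerKernel_sub_add_eq (ht : 0 < t)
    (h : ∀ x y, IsStableBridge α t x y X (P t x y)) (hVm : Measurable V)
    (hM : ∀ z, |V z| ≤ M) (x y : EuclideanSpace ℝ (Fin d)) :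
    schrodingerKernel α X P V t x y - stableDensity α t (x - y) +
        stableDensity α t (x - y) * ∫ ω, (∫ s in (0 : ℝ)..t, V (X s ω)) ∂(P t x y) =
      stableDensity α t (x - y) * ∫ ω, (Real.exp (-∫ s in (0 : ℝ)..t, V (X s ω)) - 1 +
        ∫ s in (0 : ℝ)..t, V (X s ω)) ∂(P t x y) := by
  have := (h x y).isProbabilityMeasure
  have he := (h x y).integrable_exp ht hVm hM
  have hi := (h x y).integrable_intervalIntegral ht hVm hM
  have hs : Integrable (fun ω => Real.exp (-∫ s in (0 : ℝ)..t, V (X s ω)) - 1) (P t x y) :=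
    he.sub (integrable_const 1)
  rw [integral_add hs hi, integral_sub he (integrable_const 1)]
  simp only [schrodingerKernel, integral_const, probReal_univ, one_smul]
  ring

lemma remainder_nonneg
    (hpos : ∀ s z, 0 < s → 0 < stableDensity (d := d) α s z) (ht : 0 < t)
    (x y : EuclideanSpace ℝ (Fin d)) :
    0 ≤ stableDensity α t (x - y) * ∫ ω, (Real.exp (-∫ s in (0 : ℝ)..t, V (X s ω)) - 1 +
        ∫ s in (0 : ℝ)..t, V (X s ω)) ∂(P t x y) := by
  refine mul_nonneg (hpos _ _ ht).le (integral_nonneg fun ω => ?_)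
  have := Real.add_one_le_exp (-∫ s in (0 : ℝ)..t, V (X s ω))
  simp only [Pi.zero_apply]
  linarith

lemma remainder_le (hpos : ∀ s z, 0 < s → 0 < stableDensity (d := d) α s z) (ht : 0 < t)
    (h : ∀ x y, IsStableBridge α t x y X (P t x y)) (hVm : Measurable V)
    (hM : ∀ z, |V z| ≤ M) (x y : EuclideanSpace ℝ (Fin d)) :
    stableDensity α t (x - y) * ∫ ω, (Real.exp (-∫ s in (0 : ℝ)..t, V (X s ω)) - 1 +
        ∫ s in (0 : ℝ)..t, V (X s ω)) ∂(P t x y) ≤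
      1 / 2 * t * M * Real.exp (t * M) * (stableDensity α t (x - y) *
        ∫ ω, (∫ s in (0 : ℝ)..t, |V (X s ω)|) ∂(P t x y)) := by
  have := (h x y).isProbabilityMeasure
  rw [mul_left_comm, ← integral_const_mul (1 / 2 * t * M * Real.exp (t * M))]
  refine mul_le_mul_of_nonneg_left (integral_mono ?_ ?_ fun ω => ?_) (hpos _ _ ht).le
  · exact (((h x y).integrable_exp ht hVm hM).sub (integrable_const 1)).add
      ((h x y).integrable_intervalIntegral ht hVm hM)
  · exact ((h x y).integrable_intervalIntegral ht (V := fun z => |V z|) hVm.norm (M := M)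
      (by simpa using hM)).const_mul _
  · exact (le_abs_self _).trans (abs_exp_path_sub_le ht hM _)

/-- The heat content of a Borel potential that is bounded everywhere, up to second order. -/
lemma heatContent_bounds_of_measurable (hd : 1 ≤ d) (hα : 0 < α) (ht : 0 < t)
    (hpos : ∀ s z, 0 < s → 0 < stableDensity (d := d) α s z)
    (h : ∀ x y, IsStableBridge α t x y X (P t x y)) (hVm : Measurable V) (hV : Integrable V)
    (hM0 : 0 ≤ M) (hM : ∀ z, |V z| ≤ M) :
    Integrable (fun z : EuclideanSpace ℝ (Fin d) × EuclideanSpace ℝ (Fin d) =>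
      schrodingerKernel α X P V t z.1 z.2 - stableDensity α t (z.1 - z.2)) (volume.prod volume) ∧
    0 ≤ heatContent α X P V t + t * ∫ x, V x ∧
    heatContent α X P V t + t * (∫ x, V x) ≤
      1 / 2 * t * M * Real.exp (t * M) * (t * ∫ x, |V x|) := by
  have hA := integrable_firstMoment hd hα ht hpos h hVm hV hM
  have hB := integrable_firstMoment (U := fun z => |V z|) (M := M) hd hα ht hpos h hVm.norm hV.abs
    (by simpa using hM)
  have hp : Measurable (stableDensity (d := d) α t) :=
    (continuous_stableDensity hd hα ht).measurable
  have hK : AEStronglyMeasurable (fun z : EuclideanSpace ℝ (Fin d) × EuclideanSpace ℝ (Fin d) =>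
      schrodingerKernel α X P V t z.1 z.2 - stableDensity α t (z.1 - z.2))
      (volume.prod volume) := by
    have hp2 : Measurable fun z : EuclideanSpace ℝ (Fin d) × EuclideanSpace ℝ (Fin d) =>
        stableDensity α t (z.1 - z.2) := hp.comp (by fun_prop)
    exact ((hp2.stronglyMeasurable.mul
      (stronglyMeasurable_feynmanKac hα ht h hV hM0 hM)).sub
        hp2.stronglyMeasurable).aestronglyMeasurable
  have heq := schrodingerKernel_sub_add_eq ht h hVm hM
  have hD : Integrable (fun z : EuclideanSpace ℝ (Fin d) × EuclideanSpace ℝ (Fin d) =>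
      schrodingerKernel α X P V t z.1 z.2 - stableDensity α t (z.1 - z.2) +
        stableDensity α t (z.1 - z.2) * ∫ ω, (∫ s in (0 : ℝ)..t, V (X s ω)) ∂(P t z.1 z.2))
      (volume.prod volume) := by
    refine (hB.const_mul (1 / 2 * t * M * Real.exp (t * M))).mono'
      (hK.add hA.aestronglyMeasurable) (Eventually.of_forall fun z => ?_)
    rw [heq, Real.norm_eq_abs, abs_of_nonneg (remainder_nonneg hpos ht _ _)]
    exact remainder_le hpos ht h hVm hM _ _
  have hKi : Integrable (fun z : EuclideanSpace ℝ (Fin d) × EuclideanSpace ℝ (Fin d) =>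
      schrodingerKernel α X P V t z.1 z.2 - stableDensity α t (z.1 - z.2))
      (volume.prod volume) :=
    (hD.sub hA).congr (Eventually.of_forall fun z => by simp)
  have hQ : heatContent α X P V t + t * (∫ x, V x) =
      ∫ z : EuclideanSpace ℝ (Fin d) × EuclideanSpace ℝ (Fin d),
        (schrodingerKernel α X P V t z.1 z.2 - stableDensity α t (z.1 - z.2) +
        stableDensity α t (z.1 - z.2) * ∫ ω, (∫ s in (0 : ℝ)..t, V (X s ω)) ∂(P t z.1 z.2))
        ∂(volume.prod volume) := by
    rw [integral_add hKi hA, integral_firstMoment hd hα ht hpos h hVm hV hM,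
      integral_prod_symm _ hKi]
    rfl
  refine ⟨hKi, ?_, ?_⟩
  · rw [hQ]
    refine integral_nonneg fun z => ?_
    simp only [heq]
    exact remainder_nonneg hpos ht _ _
  · rw [hQ, ← integral_firstMoment (U := fun z => |V z|) (M := M) hd hα ht hpos h hVm.norm hV.abs
      (by simpa using hM), ← integral_const_mul]
    refine integral_mono hD (hB.const_mul _) fun z => ?_
    simp only [heq]
    exact remainder_le hpos ht h hVm hM _ _

/-- The Feynman–Kac kernel does not see changes of `V` on null sets. -/
lemma schrodingerKernel_congr_ae (hα : 0 < α) (ht : 0 < t)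
    (h : ∀ x y, IsStableBridge α t x y X (P t x y)) {W : EuclideanSpace ℝ (Fin d) → ℝ}
    (hVW : V =ᵐ[volume] W) (x y : EuclideanSpace ℝ (Fin d)) :
    schrodingerKernel α X P V t x y = schrodingerKernel α X P W t x y := by
  unfold schrodingerKernel
  congr 1
  refine integral_congr_ae (((h x y).ae_ae_of_ae hα ht hVW).mono fun ω hω => ?_)
  simp only [intervalIntegral.integral_of_le ht.le, integral_congr_ae hω]

lemma heatContent_bounds (hd : 1 ≤ d) (hα : 0 < α) (ht : 0 < t)
    (hpos : ∀ s z, 0 < s → 0 < stableDensity (d := d) α s z)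
    (h : ∀ x y, IsStableBridge α t x y X (P t x y))
    (hV : MemLp V ⊤ volume) (hV₁ : MemLp V 1 volume) :
    HeatContentConverges α X P V t ∧
    0 ≤ heatContent α X P V t + t * ∫ x, V x ∧
    heatContent α X P V t + t * (∫ x, V x) ≤
      1 / 2 * t * (eLpNorm V ⊤ volume).toReal * Real.exp (t * (eLpNorm V ⊤ volume).toReal) *
        (t * ∫ x, |V x|) := by
  set M := (eLpNorm V ⊤ volume).toReal with hMdef
  have hM0 : 0 ≤ M := ENNReal.toReal_nonneg
  have hbd : ∀ᵐ z, |V z| ≤ M := by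
    filter_upwards [ae_le_eLpNormEssSup (f := V) (μ := volume)] with z hz
    rw [← eLpNorm_exponent_top] at hz
    rw [← Real.norm_eq_abs, ← toReal_enorm]
    exact ENNReal.toReal_mono hV.eLpNorm_ne_top hz
  -- a Borel representative of `V`, clipped so that it is bounded everywhere
  obtain ⟨g, hgm, hVg⟩ := hV.aestronglyMeasurable.aemeasurable
  obtain ⟨W, hWm, hWM, hVW⟩ : ∃ W : EuclideanSpace ℝ (Fin d) → ℝ, Measurable W ∧
      (∀ z, |W z| ≤ M) ∧ V =ᵐ[volume] W := by
    refine ⟨fun z => max (-M) (min M (g z)), by fun_prop, fun z =>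
      abs_le.2 ⟨le_max_left _ _, max_le (by linarith) (min_le_left _ _)⟩, ?_⟩
    filter_upwards [hbd, hVg] with z hz hzg
    have := abs_le.1 hz
    rw [← hzg, min_eq_right this.2, max_eq_right this.1]
  have hV1i := memLp_one_iff_integrable.1 hV₁
  have hW : Integrable W := hV1i.congr hVW
  have hker := schrodingerKernel_congr_ae (V := V) hα ht h hVW
  have hQ : heatContent α X P V t = heatContent α X P W t := by
    simp only [heatContent, hker]
  have h1 : ∫ x, V x = ∫ x, W x := integral_congr_ae hVW
  have h2 : ∫ x, |V x| = ∫ x, |W x| := integral_congr_ae (hVW.mono fun z hz => by simp only [hz])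
  obtain ⟨hi, hlow, hup⟩ := heatContent_bounds_of_measurable hd hα ht hpos h hWm hW hM0 hWM
  rw [hQ, h1, h2]
  refine ⟨⟨fun x y => ⟨?_, ?_⟩, ?_⟩, hlow, hup⟩
  · have := (h x y).isProbabilityMeasure
    filter_upwards [(h x y).ae_ae_of_ae hα ht hVW,
      ((h x y).integrable_uncurry ht hWm hWM).prod_right_ae] with ω hω hωi
    rw [intervalIntegrable_iff_integrableOn_Ioc_of_le ht.le]
    exact hωi.congr (hω.mono fun s hs => hs.symm)
  · refine ((h x y).integrable_exp ht hWm hWM).congr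
      (((h x y).ae_ae_of_ae hα ht hVW).mono fun ω hω => ?_)
    simp only [intervalIntegral.integral_of_le ht.le, integral_congr_ae hω]
  · simpa only [hker] using hi

end HeatContent

theorem theorem1 {d : ℕ} (hd : 1 ≤ d) {α : ℝ} (hα₀ : 0 < α) (hα₂ : α ≤ 2)
    {Ω : Type*} [MeasurableSpace Ω] (X : ℝ → Ω → EuclideanSpace ℝ (Fin d))
    (P : ℝ → EuclideanSpace ℝ (Fin d) → EuclideanSpace ℝ (Fin d) → Measure Ω)
    (hX : ∀ t : ℝ, 0 < t → ∀ x y, IsStableBridge α t x y X (P t x y))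
    (V : EuclideanSpace ℝ (Fin d) → ℝ)
    (hV : MemLp V ⊤ volume) (hV₁ : MemLp V 1 volume) :
    (∀ t : ℝ, 0 < t → HeatContentConverges α X P V t) ∧
    ((∀ᵐ x, V x ≤ 0) →
      (∀ t : ℝ, 0 < t →
        -t * (∫ x, V x) ≤ heatContent α X P V t ∧
        heatContent α X P V t ≤
          (-t * (∫ x, V x)) * (1 + 1 / 2 * t * (eLpNorm V ⊤ volume).toReal *
            Real.exp (t * (eLpNorm V ⊤ volume).toReal))) ∧
      (fun t : ℝ => heatContent α X P V t - (-t * (∫ x, V x))) =O[𝓝[>] 0] (fun t => t ^ 2)) ∧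
    (∀ t : ℝ, 0 < t →
      |heatContent α X P V t + t * (∫ x, V x)| ≤
        t ^ 2 * (eLpNorm V 1 volume).toReal * (eLpNorm V ⊤ volume).toReal *
          Real.exp (t * (eLpNorm V ⊤ volume).toReal)) ∧
    (fun t : ℝ => heatContent α X P V t - (-t * (∫ x, V x))) =O[𝓝[>] 0] (fun t => t ^ 2) := by
  have hpos : ∀ s z, 0 < s → 0 < stableDensity (d := d) α s z := fun s z hs =>
    stableDensity_pos_of_ne_zero hd hα₀ hs
      (fun w => by simpa using (hX s hs w 0).stableDensity_ne_zero) z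
  have hmain := fun (t : ℝ) (ht : 0 < t) => heatContent_bounds hd hα₀ ht hpos (hX t ht) hV hV₁
  have hnorm : (eLpNorm V 1 volume).toReal = ∫ x, |V x| := by
    rw [eLpNorm_one_eq_lintegral_enorm,
      ← integral_norm_eq_lintegral_enorm hV₁.aestronglyMeasurable]
    rfl
  set M := (eLpNorm V ⊤ volume).toReal with hMdef
  have hM0 : 0 ≤ M := ENNReal.toReal_nonneg
  have hI0 : 0 ≤ ∫ x, |V x| := integral_nonneg fun _ => abs_nonneg _
  have hii : ∀ t : ℝ, 0 < t → |heatContent α X P V t + t * (∫ x, V x)| ≤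
      t ^ 2 * (eLpNorm V 1 volume).toReal * M * Real.exp (t * M) := by
    intro t ht
    obtain ⟨-, h1, h2⟩ := hmain t ht
    rw [abs_of_nonneg h1, hnorm]
    have : 0 ≤ t ^ 2 * (∫ x, |V x|) * M * Real.exp (t * M) := by positivity
    linarith
  have hO : (fun t : ℝ => heatContent α X P V t - (-t * (∫ x, V x))) =O[𝓝[>] 0]
      (fun t => t ^ 2) := by
    refine Asymptotics.IsBigO.of_bound ((∫ x, |V x|) * M * Real.exp M) ?_
    filter_upwards [Ioo_mem_nhdsGT (zero_lt_one' ℝ)] with t ht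
    rw [neg_mul, sub_neg_eq_add, Real.norm_eq_abs, Real.norm_eq_abs, abs_of_nonneg (sq_nonneg t)]
    calc _ ≤ t ^ 2 * (eLpNorm V 1 volume).toReal * M * Real.exp (t * M) := hii t ht.1
      _ ≤ t ^ 2 * (eLpNorm V 1 volume).toReal * M * Real.exp M := by
        have : t * M ≤ M := mul_le_of_le_one_left hM0 ht.2.le
        gcongr
      _ = _ := by rw [hnorm]; ring
  refine ⟨fun t ht => (hmain t ht).1, fun hneg => ⟨fun t ht => ?_, hO⟩, hii, hO⟩
  obtain ⟨-, h1, h2⟩ := hmain t ht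
  have habs : ∫ x, |V x| = -∫ x, V x := by
    rw [← integral_neg]
    exact integral_congr_ae (hneg.mono fun x hx => abs_of_nonpos hx)
  rw [habs] at h2
  exact ⟨by linarith, by linarith⟩
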